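/- Let $\Lambda$ be the complex Grassmann algebra on two odd generators $\eta,\bar\eta$, with the antilinear, multiplicative, parity preserving conjugation determined by $\eta\mapsto\bar\eta$, $\bar\eta\mapsto-\eta$. Let $V_\pm$ denote the odd generators of $\mathfrak{osp}(1|2)_{\mathbb C}$. Through $(g,\eta,\bar\eta)\mapsto g\cdot\exp(\bar\eta V_++\eta V_-)$ identify $\mathrm{UOSp}(1|2)$ with $\mathrm{SU}(2)\times$(odd part), so that a function on $\mathrm{UOSp}(1|2)$ is a function $f:\mathrm{SU}(2)\to\Lambda$. The invariant integral is $$\int_{\mathrm{UOSp}(1|2)}f=\int_{\mathrm{SU}(2)}d\sigma(g)\int_B d\bar\eta\,d\eta\,\Bigl(1-\tfrac14\bar\eta\eta\Bigr)f(g),$$ where $\sigma$ is $4$ times the normalized Haar measure of $\mathrm{SU}(2)$ and $\int_B d\bar\eta\,d\eta$ is the Berezin integral (left derivative in $\eta$, then in $\bar\eta$, so that $\int_B d\bar\eta\,d\eta\,\bar\eta\eta=-1$). Put $\mathscr S(f|h)=\int_{\mathrm{UOSp}(1|2)}\bar f h$. For $j\in\frac12\mathbb N_0$ let $\pi_j$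 be the finite-dimensional irreducible representation of $\mathrm{UOSp}(1|2)$ on $V_j\oplus\Pi V_{j-1/2}$ (of dimension $(2j+1|2j)$). Here $\mathrm{SU}(2)$ acts by the spin-$j$ and spin-$(j-\frac12)$ representations, written in their orthonormal weight bases $|j,m\rangle$ and $|j-\frac12,m\rangle$ (the second summand is $0$ for $j=0$), the odd generators act by $$V_+|j,m\rangle=-\tfrac12\sqrt{j-m}\,|j-\tfrac12,m+\tfrac12\rangle,\qquad V_+|j-\tfrac12,m\rangle=-\tfrac12\sqrt{j+m+\tfrac12}\,|j,m+\tfrac12\rangle,$$ $$V_-|j,m\rangle=\tfrac12\sqrt{j+m}\,|j-\tfrac12,m-\tfrac12\rangle,\qquad V_-|j-\tfrac12,m\rangle=-\tfrac12\sqrt{j-m+\tfrac12}\,|j,m-\tfrac12\rangle,$$ and $\pi_j(g,\eta,\bar\eta)=\pi_j(g)\exp(\bar\eta V_++\eta V_-)$ as a matrix with entries in $\Lambda$. Let $T^j_{j\,m_1,j\,m_2}$ and $T^j_{j-\frac12\,m_1,j-\frac12\,m_2}$ be the entries of its even and odd diagonal blocks, and let $\chi_j=\mathrm{str}\,\pi_j=\sum_m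 T^j_{j\,m,j\,m}-\sum_m T^j_{j-\frac12\,m,j-\frac12\,m}$. Then for all $j,j'\in\frac12\mathbb N_0$ and all indices the following hold. 1. The integrands of all super scalar products $\mathscr S(\cdot|\cdot)$ of matrix coefficients (of all four blocks) and of characters are, after Berezin integration, integrable on $\mathrm{SU}(2)$. 2. $\mathscr S(T^j_{j\,m_1,j\,m_2}|T^{j'}_{j'\,m_1',j'\,m_2'})=\delta_{jj'}\delta_{m_1m_1'}\delta_{m_2m_2'}$. 3. $\mathscr S(T^j_{j-\frac12\,m_1,j-\frac12\,m_2}|T^{j'}_{j'-\frac12\,m_1',j'-\frac12\,m_2'})=-\delta_{jj'}\delta_{m_1m_1'}\delta_{m_2m_2'}$. 4. $\mathscr S(T^j_{j\,m_1,j\,m_2}|T^{j'}_{j'-\frac12\,m_1',j'-\frac12\,m_2'})=0$, and the same with the two arguments exchanged. 5. $\mathscr S(\chi_j|\chi_{j'})=\delta_{jj'}$. 6. With $d_j=4j+1$, for every $g\in\mathrm{SU}(2)$ and every $\theta\in\mathbb R$ with $\operatorname{tr}g=2\cos\theta$, $$\chi_j(g,\eta,\bar\eta)=\Bigl(1+\tfrac1{16}\bar\eta\eta\Bigr)\frac{\cos(d_j\theta/2)}{\cos(\theta/2)}-\frac{d_j}{16}\,\frac{\sin(d_j\theta/2)}{\sin(\theta/2)}\,\bar\eta\eta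 ,$$ where the two quotients are extended continuously in $\theta$ to the zeros of their denominators. -/

import Mathlib

open scoped TensorProduct

namespace UOSp12

noncomputable section

/-! ### The complex Grassmann algebra on two odd generators -/

/-- The real Grassmann algebra on two odd generators. -/
abbrev RealGrassmann : Type := ExteriorAlgebra ℝ (Fin 2 → ℝ)

/-- The complex Grassmann algebra `Λ₂^ℂ`, as the complexification of the real one. -/
def Grassmann : Type := ℂ ⊗[ℝ] RealGrassmann

instance : Ring Grassmann := inferInstanceAs (Ring (ℂ ⊗[ℝ] RealGrassmann))

instance : Algebra ℂ Grassmann := inferInstanceAs (Algebra ℂ (ℂ ⊗[ℝ] RealGrassmann))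

instance : Algebra ℚ Grassmann := inferInstanceAs (Algebra ℚ (ℂ ⊗[ℝ] RealGrassmann))

/-- The identity map from the tensor product to `Grassmann`. -/
def ofTensor : (ℂ ⊗[ℝ] RealGrassmann) ≃ₐ[ℂ] Grassmann :=
  (AlgEquiv.refl : (ℂ ⊗[ℝ] RealGrassmann) ≃ₐ[ℂ] (ℂ ⊗[ℝ] RealGrassmann))

/-- The odd generator `η`. -/
def eta : Grassmann := ofTensor (1 ⊗ₜ[ℝ] ExteriorAlgebra.ι ℝ (Pi.single 0 1 : Fin 2 → ℝ))

/-- The odd generator `η̄`. -/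
def etaBar : Grassmann := ofTensor (1 ⊗ₜ[ℝ] ExteriorAlgebra.ι ℝ (Pi.single 1 1 : Fin 2 → ℝ))

/-- The conjugation of the second kind: the antilinear, multiplicative, parity preserving map with
`η ↦ η̄` and `η̄ ↦ -η` (so that its square is `(-1)^{|α|}` on a homogeneous `α`). -/
def grConj : Grassmann →+* Grassmann :=
  (ofTensor : (ℂ ⊗[ℝ] RealGrassmann) →+* Grassmann).comp
    (((Algebra.TensorProduct.map (Complex.conjAe : ℂ →ₐ[ℝ] ℂ)
      (ExteriorAlgebra.map (Matrix.toLin' !![(0 : ℝ), -1; 1, 0])) :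
        (ℂ ⊗[ℝ] RealGrassmann) →ₐ[ℝ] (ℂ ⊗[ℝ] RealGrassmann)) :
          (ℂ ⊗[ℝ] RealGrassmann) →+* (ℂ ⊗[ℝ] RealGrassmann)).comp
      (ofTensor.symm : Grassmann →+* (ℂ ⊗[ℝ] RealGrassmann)))

/-- The left derivative with respect to the odd generator with index `i` (`0` for `η`, `1` for
`η̄`): the `ℂ`-linear odd derivation that contracts with the `i`-th dual basis vector. -/
def oddDeriv (i : Fin 2) : Grassmann →ₗ[ℂ] Grassmann :=
  ofTensor.toLinearMap ∘ₗ
    ((CliffordAlgebra.contractLeft (Q := (0 : QuadraticForm ℝ (Fin 2 → ℝ)))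
      (LinearMap.proj i : Module.Dual ℝ (Fin 2 → ℝ))).baseChange ℂ :
        (ℂ ⊗[ℝ] RealGrassmann) →ₗ[ℂ] (ℂ ⊗[ℝ] RealGrassmann)) ∘ₗ
      ofTensor.symm.toLinearMap

/-- The body map `Λ₂^ℂ → ℂ`, which sends both odd generators to zero. -/
def body : Grassmann →ₐ[ℂ] ℂ :=
  ((Algebra.TensorProduct.rid ℝ ℂ ℂ : ℂ ⊗[ℝ] ℝ →ₐ[ℂ] ℂ).comp
    (Algebra.TensorProduct.map (AlgHom.id ℂ ℂ)
      (ExteriorAlgebra.algebraMapInv : RealGrassmann →ₐ[ℝ] ℝ))).comp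
        (ofTensor.symm : Grassmann →ₐ[ℂ] (ℂ ⊗[ℝ] RealGrassmann))

/-- The Berezin integral `∫_B dη̄ dη`: first `∂/∂η`, then `∂/∂η̄`. -/
def berezin (x : Grassmann) : ℂ := body (oddDeriv 1 (oddDeriv 0 x))

/-! ### The group `SU(2)` and its invariant measure -/

/-- The group `SU(2)`. -/
abbrev SU2 : Type := Matrix.specialUnitaryGroup (Fin 2) ℂ

instance : IsTopologicalGroup SU2 where
  continuous_inv := by
    refine continuous_induced_rng.mpr ?_
    exact continuous_star.comp continuous_subtype_val

instance : CompactSpace SU2 := by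
  refine isCompact_iff_compactSpace.mp (IsCompact.of_isClosed_subset
    (isCompact_univ_pi fun _ : Fin 2 => isCompact_univ_pi fun _ : Fin 2 =>
      isCompact_closedBall (0 : ℂ) 1) ?_ ?_)
  · have h : ((Matrix.specialUnitaryGroup (Fin 2) ℂ : Submonoid _) : Set (Matrix (Fin 2) (Fin 2) ℂ))
        = (Matrix.unitaryGroup (Fin 2) ℂ : Set (Matrix (Fin 2) (Fin 2) ℂ)) ∩
          {A | A.det = 1} := by
      ext A
      exact Matrix.mem_specialUnitaryGroup_iff
    have hu : IsClosed (Matrix.unitaryGroup (Fin 2) ℂ : Set (Matrix (Fin 2) (Fin 2) ℂ)) :=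
      isClosed_unitary
    exact h ▸ hu.inter (isClosed_eq (Continuous.matrix_det continuous_id) continuous_const)
  · intro A hA i _ j _
    simpa using entry_norm_bound_of_unitary (Matrix.mem_specialUnitaryGroup_iff.mp hA).1 i j

instance : MeasurableSpace SU2 := borel SU2

instance : BorelSpace SU2 := ⟨rfl⟩

/-- The measure `dσ` on `SU(2) ≅ 𝕊³`: four times the normalized invariant measure. -/
def sigma : MeasureTheory.Measure SU2 := (4 : ENNReal) • MeasureTheory.Measure.haarMeasure ⊤

/-! ### The invariant integral and the super scalar product

Through `(g, η, η̄) ↦ g · exp (η̄ V₊ + η V₋)` the supergroup `UOSp(1|2)` is the split supermanifold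
`SU(2) × (odd part)`, and a superfunction on it is a map `SU(2) → Λ₂^ℂ`. -/

/-- The fibre integral `∫_B dη̄ dη (1 - η̄η/4) f(g, η, η̄)`, as a function of `g`. -/
def fibreIntegral (f : SU2 → Grassmann) (g : SU2) : ℂ :=
  berezin ((1 - (1 / 4 : ℂ) • (etaBar * eta)) * f g)

/-- Integrability of a superfunction on `UOSp(1|2)`. -/
def SuperIntegrable (f : SU2 → Grassmann) : Prop :=
  MeasureTheory.Integrable (fibreIntegral f) sigma

/-- The invariant integral `∫_{SU(2)} dσ ∫_B dη̄ dη (1 - η̄η/4) f` on `UOSp(1|2)`. -/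
def superIntegral (f : SU2 → Grassmann) : ℂ := ∫ g, fibreIntegral f g ∂sigma

/-- The super scalar product `𝒮(f|h) = ∫ f̄ h` on `UOSp(1|2)`. -/
def superInner (f h : SU2 → Grassmann) : ℂ := superIntegral (fun g => grConj (f g) * h g)

/-! ### The irreducible representations -/

/-- The irreducible representation of `SU(2)` of dimension `N = 2J + 1` (spin `J`), that is, the
representation `(g x) = a x + c y`, `(g y) = b x + d y` for `g = (a b; c d)` on homogeneous
polynomials of degree `N - 1` in `x, y`, in the orthonormal weight basis
`e_k = x ^ k y ^ (N - 1 - k) / √(k! (N - 1 - k)!)`, which has weight `m = k - J`.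
(The polynomials are written dehomogenized, `x = X` and `y = 1`.) -/
def spinMatrix (N : ℕ) (g : SU2) : Matrix (Fin N) (Fin N) ℂ := Matrix.of fun k l =>
  ((Real.sqrt (((k : ℕ).factorial * (N - 1 - (k : ℕ)).factorial : ℕ) : ℝ) /
      Real.sqrt (((l : ℕ).factorial * (N - 1 - (l : ℕ)).factorial : ℕ) : ℝ) : ℝ) : ℂ) *
    ((Polynomial.C (g.1 0 0) * Polynomial.X + Polynomial.C (g.1 1 0)) ^ (l : ℕ) *
      (Polynomial.C (g.1 0 1) * Polynomial.X + Polynomial.C (g.1 1 1)) ^ (N - 1 - (l : ℕ))).coeff (k : ℕ)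

/-- Indices of the weight basis of `V_j ⊕ Π V_{j-1/2}`, where `n = 2j`. The index `inl k` stands for
`|j, m⟩` with `m = k - j`, and `inr k` for `|j - 1/2, m⟩` with `m = k - (j - 1/2)`. -/
abbrev Idx (n : ℕ) : Type := Fin (n + 1) ⊕ Fin n

/-- The odd generator `V₊` of `osp(1|2)` in the irreducible representation with `n = 2j`:
`V₊ |j, m⟩ = -(1/2) √(j - m) |j - 1/2, m + 1/2⟩`,
`V₊ |j - 1/2, m⟩ = -(1/2) √(j + m + 1/2) |j, m + 1/2⟩`. -/
def vPlus (n : ℕ) : Matrix (Idx n) (Idx n) ℂ :=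
  Matrix.fromBlocks 0
    (Matrix.of fun k l => if (k : ℕ) = l + 1 then ((-(1 / 2) * Real.sqrt ((l : ℕ) + 1) : ℝ) : ℂ) else 0)
    (Matrix.of fun k l => if (k : ℕ) = l then ((-(1 / 2) * Real.sqrt ((n : ℝ) - (l : ℕ)) : ℝ) : ℂ) else 0)
    0

/-- The odd generator `V₋` of `osp(1|2)` in the irreducible representation with `n = 2j`:
`V₋ |j, m⟩ = (1/2) √(j + m) |j - 1/2, m - 1/2⟩`,
`V₋ |j - 1/2, m⟩ = -(1/2) √(j - m + 1/2) |j, m - 1/2⟩`. -/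
def vMinus (n : ℕ) : Matrix (Idx n) (Idx n) ℂ :=
  Matrix.fromBlocks 0
    (Matrix.of fun k l => if (k : ℕ) = l then ((-(1 / 2) * Real.sqrt ((n : ℝ) - (l : ℕ)) : ℝ) : ℂ) else 0)
    (Matrix.of fun k l => if (k : ℕ) + 1 = l then (((1 / 2) * Real.sqrt (l : ℕ) : ℝ) : ℂ) else 0)
    0

/-- A complex matrix, seen as a matrix with entries in the Grassmann algebra. -/
def toGr (n : ℕ) (M : Matrix (Idx n) (Idx n) ℂ) : Matrix (Idx n) (Idx n) Grassmann :=
  M.map (algebraMap ℂ Grassmann)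

/-- The representation `π_j`, `n = 2j`, of `UOSp(1|2)`, at the group element
`g · exp (η̄ V₊ + η V₋)`. The argument of `exp` is nilpotent, so the exponential series is finite. -/
def irrep (n : ℕ) (g : SU2) : Matrix (Idx n) (Idx n) Grassmann :=
  toGr n (Matrix.fromBlocks (spinMatrix (n + 1) g) 0 0 (spinMatrix n g)) *
    IsNilpotent.exp (etaBar • toGr n (vPlus n) + eta • toGr n (vMinus n))

/-- The supertrace of an even supermatrix. -/
def superTrace (n : ℕ) (M : Matrix (Idx n) (Idx n) Grassmann) : Grassmann :=
  ∑ k, M (Sum.inl k) (Sum.inl k) - ∑ k, M (Sum.inr k) (Sum.inr k)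

/-- The matrix coefficients of `π_j`, `n = 2j`, as superfunctions on `UOSp(1|2)`. -/
def coeffFun (n : ℕ) (a b : Idx n) (g : SU2) : Grassmann := irrep n g a b

/-- The super character `χ_j = str π_j`, `n = 2j`. -/
def superChar (n : ℕ) (g : SU2) : Grassmann := superTrace n (irrep n g)

end

end UOSp12

namespace UOSp12

noncomputable section

/-! ### The symmetric powers of a two by two matrix -/

/-! Write `n = 2j` and `ξ = η̄η`, so `ξ² = 0`. The square of `η̄ V₊ + η V₋` is `ξ [V₊, V₋]`, its
cube vanishes, and `[V₊, V₋]` is the scalar `-n/4` on the even block and `(n+1)/4` on the odd block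
(`vPlus_mul_vMinus_sub`). The diagonal blocks of `π_j` are therefore the spin matrices of sizes
`n+1` and `n`, multiplied by `1 - (n/8) ξ` and `1 + ((n+1)/8) ξ`.

Conjugation fixes `ξ`, so the product of `1 + α ξ`, `1 + β ξ` and the density `1 - ξ/4` has Berezin
integral `1/4 - α - β`. Each super scalar product thus becomes `1 - 4(α + β)` times a Haar integral
on `SU(2)` (`superInner_smul_evenElt`). Against the Schur constants `1/(n+1)` and `1/n`, this factor
is `n+1` for two even entries and `-n` for two odd ones, which gives `1` and `-1`. An even and an
odd entry can only meet when `n + 1 = n'`, and then the factor is `0`. The characters give `(n+1) -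
n = 1` in the same way.

Schur orthogonality (`integral_star_spinMatrix_mul`) comes from averaging to an intertwiner, which
is determined by one generic torus element and one group element with no zero in its last row and
column. For the closed form, the traces of the spin matrices are `U_n(cos θ)` and `U_{n-1}(cos θ)`;
the difference and the sum of these Chebyshev polynomials are the two trigonometric quotients,
continuously extended. -/

/-- The matrix of the `n`-th symmetric power of `g`, in the basis `x ^ k y ^ (n - k)`. -/
def symPow (n : ℕ) (g : Matrix (Fin 2) (Fin 2) ℂ) : Matrix (Fin (n + 1)) (Fin (n + 1)) ℂ :=
  Matrix.of fun k l =>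
    ((Polynomial.C (g 0 0) * Polynomial.X + Polynomial.C (g 1 0)) ^ (l : ℕ) *
      (Polynomial.C (g 0 1) * Polynomial.X + Polynomial.C (g 1 1)) ^ (n - (l : ℕ))).coeff (k : ℕ)

/-- Homogenizing undoes the substitution `y = 1`: column `l` is a product of `n` linear forms and
can be evaluated at any point `(u, v)`, in particular at the linear forms of another matrix. -/
lemma sum_symPow_mul (n : ℕ) (g : Matrix (Fin 2) (Fin 2) ℂ) (l : Fin (n + 1)) (u v : ℂ) :
    ∑ k, symPow n g k l * (u ^ (k : ℕ) * v ^ (n - (k : ℕ))) =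
      (g 0 0 * u + g 1 0 * v) ^ (l : ℕ) * (g 0 1 * u + g 1 1 * v) ^ (n - (l : ℕ)) := by
  set p : Polynomial ℂ := (Polynomial.C (g 0 0) * Polynomial.X + Polynomial.C (g 1 0)) ^ (l : ℕ) *
      (Polynomial.C (g 0 1) * Polynomial.X + Polynomial.C (g 1 1)) ^ (n - (l : ℕ)) with hp
  have key : p.homogenize n =
      (MvPolynomial.C (g 0 0) * MvPolynomial.X 0 + MvPolynomial.C (g 1 0) * MvPolynomial.X 1)
        ^ (l : ℕ) *
      (MvPolynomial.C (g 0 1) * MvPolynomial.X 0 + MvPolynomial.C (g 1 1) * MvPolynomial.X 1)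
        ^ (n - (l : ℕ)) := by
    apply Polynomial.homogenize_eq_of_isHomogeneous
    · have hlin : ∀ a b : ℂ, (MvPolynomial.C a * MvPolynomial.X 0 +
          MvPolynomial.C b * MvPolynomial.X 1 : MvPolynomial (Fin 2) ℂ).IsHomogeneous 1 :=
        fun a b => (MvPolynomial.isHomogeneous_C_mul_X _ _).add
          (MvPolynomial.isHomogeneous_C_mul_X _ _)
      have := ((hlin (g 0 0) (g 1 0)).pow (l : ℕ)).mul ((hlin (g 0 1) (g 1 1)).pow (n - (l : ℕ)))
      convert this using 1
      have := l.2
      omega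
    · simp [hp]
  have h2 := congrArg (MvPolynomial.eval ![u, v]) key
  simp only [map_mul, map_pow, map_add, MvPolynomial.eval_C, MvPolynomial.eval_X,
    Matrix.cons_val_zero, Matrix.cons_val_one] at h2
  rw [← h2, Polynomial.homogenize, Finset.Nat.antidiagonal_eq_map, Finset.sum_map, map_sum,
    Finset.sum_range]
  refine Finset.sum_congr rfl fun k _ => ?_
  simp [symPow, MvPolynomial.eval_monomial, Finsupp.prod_fintype, hp]
  rfl

lemma eq_of_sum_mul_pow_eq {n : ℕ} {c d : Fin n → ℂ}
    (h : ∀ u : ℂ, ∑ k, c k * u ^ (k : ℕ) = ∑ k, d k * u ^ (k : ℕ)) : c = d := by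
  have hp : (∑ k : Fin n, Polynomial.C (c k) * Polynomial.X ^ (k : ℕ)) =
      ∑ k : Fin n, Polynomial.C (d k) * Polynomial.X ^ (k : ℕ) := by
    refine Polynomial.funext fun u => ?_
    simpa [Polynomial.eval_finsetSum] using h u
  funext k
  have := congrArg (fun p => Polynomial.coeff p (k : ℕ)) hp
  simpa [Polynomial.coeff_C_mul, Polynomial.coeff_X_pow, Fin.val_inj] using this

lemma symPow_mul (n : ℕ) (g h : Matrix (Fin 2) (Fin 2) ℂ) :
    symPow n (g * h) = symPow n g * symPow n h := by
  ext k l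
  refine congrFun (eq_of_sum_mul_pow_eq (c := fun k => symPow n (g * h) k l)
    (d := fun k => (symPow n g * symPow n h) k l) fun u => ?_) k
  have h1 := sum_symPow_mul n (g * h) l u 1
  simp only [one_pow, mul_one] at h1
  rw [h1]
  have h2 : ∀ m, ∑ k, symPow n g k m * u ^ (k : ℕ) =
      (g 0 0 * u + g 1 0) ^ (m : ℕ) * (g 0 1 * u + g 1 1) ^ (n - (m : ℕ)) := fun m => by
    simpa using sum_symPow_mul n g m u 1
  -- Evaluating the column of `h` at the linear forms of `g` is composition of the two
  -- substitutions.
  have h3 := sum_symPow_mul n h l (g 0 0 * u + g 1 0) (g 0 1 * u + g 1 1)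
  simp only [← h2] at h3
  calc _ = _ := by
        congr 2 <;> simp only [Matrix.mul_apply, Fin.sum_univ_two] <;> ring
    _ = _ := h3.symm
    _ = _ := by
      simp only [Matrix.mul_apply, Finset.sum_mul, Finset.mul_sum]
      rw [Finset.sum_comm]
      exact Finset.sum_congr rfl fun _ _ => Finset.sum_congr rfl fun _ _ => by ring

lemma symPow_of_lower_left_eq_zero (n : ℕ) {g : Matrix (Fin 2) (Fin 2) ℂ} (hg : g 1 0 = 0)
    (k : Fin (n + 1)) : symPow n g k k = g 0 0 ^ (k : ℕ) * g 1 1 ^ (n - (k : ℕ)) := by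
  simp only [symPow, Matrix.of_apply, hg, map_zero, add_zero, mul_pow, ← map_pow]
  rw [mul_assoc, Polynomial.coeff_C_mul, Polynomial.coeff_X_pow_mul', if_pos le_rfl,
    Nat.sub_self, Polynomial.coeff_zero_eq_eval_zero]
  simp

lemma symPow_diagonal (n : ℕ) (a d : ℂ) :
    symPow n (Matrix.diagonal ![a, d]) =
      Matrix.diagonal fun k : Fin (n + 1) => a ^ (k : ℕ) * d ^ (n - (k : ℕ)) := by
  ext k l
  simp [symPow, Matrix.diagonal_apply, mul_pow, ← map_pow, mul_right_comm _ (Polynomial.X ^ _),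
    ← map_mul, Polynomial.coeff_X_pow, Fin.val_inj]
  grind

lemma symPow_one (n : ℕ) : symPow n 1 = 1 := by
  have : (1 : Matrix (Fin 2) (Fin 2) ℂ) = Matrix.diagonal ![1, 1] := by
    ext i j; fin_cases i <;> fin_cases j <;> simp
  rw [this, symPow_diagonal]
  simp

/-- The generating function of the left side in `u` and `t` is `(t (a u + c) + (b u + d)) ^ n`,
which is unchanged when `g` is transposed and `u`, `t` are exchanged. -/
lemma choose_mul_symPow (n : ℕ) (g : Matrix (Fin 2) (Fin 2) ℂ) (k l : Fin (n + 1)) :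
    (n.choose l : ℂ) * symPow n g k l = n.choose k * symPow n g.transpose l k := by
  have hgen : ∀ (g : Matrix (Fin 2) (Fin 2) ℂ) (u t : ℂ),
      ∑ k : Fin (n + 1), (∑ l : Fin (n + 1), n.choose l * symPow n g k l * t ^ (l : ℕ)) *
        u ^ (k : ℕ) = (t * (g 0 0 * u + g 1 0) + (g 0 1 * u + g 1 1)) ^ n := by
    intro g u t
    have h2 : ∀ m, ∑ k, symPow n g k m * u ^ (k : ℕ) =
        (g 0 0 * u + g 1 0) ^ (m : ℕ) * (g 0 1 * u + g 1 1) ^ (n - (m : ℕ)) := fun m => by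
      simpa using sum_symPow_mul n g m u 1
    simp only [Finset.sum_mul]
    rw [Finset.sum_comm, add_pow, Finset.sum_range]
    refine Finset.sum_congr rfl fun l _ => ?_
    rw [mul_pow, mul_assoc (t ^ _), ← h2, Finset.mul_sum, Finset.sum_mul]
    exact Finset.sum_congr rfl fun k _ => by ring
  have h1 : ∀ t : ℂ, (fun k => ∑ l : Fin (n + 1), n.choose l * symPow n g k l * t ^ (l : ℕ)) =
      fun k : Fin (n + 1) => ∑ l : Fin (n + 1), n.choose k * symPow n g.transpose l k * t ^ (l : ℕ) := by
    intro t
    refine eq_of_sum_mul_pow_eq fun u => ?_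
    rw [hgen]
    have := hgen g.transpose t u
    simp only [Finset.sum_mul, Matrix.transpose_apply] at this ⊢
    rw [Finset.sum_comm] at this
    calc _ = _ := by ring
      _ = _ := this.symm
      _ = _ := Finset.sum_congr rfl fun _ _ => Finset.sum_congr rfl fun _ _ => by ring
  exact congrFun (eq_of_sum_mul_pow_eq (c := fun l : Fin (n + 1) => n.choose l * symPow n g k l)
    (d := fun l => n.choose k * symPow n g.transpose l k) fun t => congrFun (h1 t) k) l

lemma symPow_conj (n : ℕ) (g : Matrix (Fin 2) (Fin 2) ℂ) (k l : Fin (n + 1)) :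
    star (symPow n g k l) = symPow n (g.map star) k l := by
  simp only [symPow, Matrix.of_apply, Matrix.map_apply]
  have := Polynomial.coeff_map (starRingEnd ℂ)
    (p := (Polynomial.C (g 0 0) * Polynomial.X + Polynomial.C (g 1 0)) ^ (l : ℕ) *
      (Polynomial.C (g 0 1) * Polynomial.X + Polynomial.C (g 1 1)) ^ (n - (l : ℕ))) (k : ℕ)
  simpa using this.symm

/-- A two by two matrix over `ℂ` is conjugate to an upper triangular one. -/
lemma exists_mul_eq_mul_upperTriangular (g : Matrix (Fin 2) (Fin 2) ℂ) {a d : ℂ}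
    (htr : g.trace = a + d) (hdet : g.det = a * d) :
    ∃ P Q T : Matrix (Fin 2) (Fin 2) ℂ, P * Q = 1 ∧ Q * P = 1 ∧ g * P = P * T ∧
      T 1 0 = 0 ∧ T 0 0 = a ∧ T 1 1 = d := by
  -- By trace and determinant, `a` is a root of the characteristic polynomial; its eigenvector
  -- becomes the first column of `P`.
  have h0 : (g - a • (1 : Matrix (Fin 2) (Fin 2) ℂ)).det = 0 := by
    rw [Matrix.trace_fin_two] at htr
    rw [Matrix.det_fin_two] at hdet ⊢
    simp only [Matrix.sub_apply, Matrix.smul_apply, Matrix.one_apply_eq, smul_eq_mul, mul_one, ne_eq,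
      zero_ne_one, one_ne_zero, not_false_eq_true, Matrix.one_apply_ne, mul_zero, sub_zero]
    linear_combination hdet - a * htr
  obtain ⟨v, hv, hgv⟩ := Matrix.exists_mulVec_eq_zero_iff.mpr h0
  have hgv0 := congrFun hgv 0
  have hgv1 := congrFun hgv 1
  simp [Matrix.mulVec, dotProduct, Fin.sum_univ_two, Matrix.one_apply] at hgv0 hgv1
  obtain ⟨P, hP0, hP1, hP⟩ : ∃ P : Matrix (Fin 2) (Fin 2) ℂ, P 0 0 = v 0 ∧ P 1 0 = v 1 ∧
      IsUnit P.det := by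
    by_cases h : v 0 = 0
    · have h1 : v 1 ≠ 0 := fun h1 => hv (by ext i; fin_cases i <;> simp [h, h1])
      exact ⟨!![v 0, 1; v 1, 0], by simp, by simp, by simp [Matrix.det_fin_two, h1]⟩
    · exact ⟨!![v 0, 0; v 1, 1], by simp, by simp, by simp [Matrix.det_fin_two, h]⟩
  have hQP : P⁻¹ * P = 1 := Matrix.nonsing_inv_mul P hP
  have hPQ : P * P⁻¹ = 1 := Matrix.mul_nonsing_inv P hP
  have hcol : ∀ i, (g * P) i 0 = a * P i 0 := by
    intro i
    fin_cases i <;> simp [Matrix.mul_apply, Fin.sum_univ_two, hP0, hP1]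
    · linear_combination hgv0
    · linear_combination hgv1
  have hT : ∀ i, (P⁻¹ * (g * P)) i 0 = a * (1 : Matrix (Fin 2) (Fin 2) ℂ) i 0 := by
    intro i
    rw [← hQP, Matrix.mul_apply, Matrix.mul_apply, Finset.mul_sum]
    exact Finset.sum_congr rfl fun j _ => by rw [hcol]; ring
  refine ⟨P, P⁻¹, P⁻¹ * (g * P), hPQ, hQP, by rw [← mul_assoc, hPQ, one_mul], ?_, ?_, ?_⟩
  · simpa using hT 1
  · simpa using hT 0
  · have ht : (P⁻¹ * (g * P)).trace = g.trace := by
      rw [Matrix.trace_mul_comm, mul_assoc, hPQ, mul_one]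
    rw [htr, Matrix.trace_fin_two, hT 0] at ht
    simpa using ht

lemma trace_symPow (n : ℕ) (g : Matrix (Fin 2) (Fin 2) ℂ) {a d : ℂ}
    (htr : g.trace = a + d) (hdet : g.det = a * d) :
    (symPow n g).trace = ∑ k ∈ Finset.range (n + 1), a ^ k * d ^ (n - k) := by
  obtain ⟨P, Q, T, hPQ, hQP, hgP, h10, h00, h11⟩ := exists_mul_eq_mul_upperTriangular g htr hdet
  have hg : g = P * (T * Q) := by rw [← mul_assoc, ← hgP, mul_assoc, hPQ, mul_one]
  rw [hg, symPow_mul, symPow_mul, Matrix.trace_mul_comm, mul_assoc, ← symPow_mul, hQP, symPow_one,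
    mul_one, Matrix.trace, Finset.sum_range]
  refine Finset.sum_congr rfl fun k _ => ?_
  rw [Matrix.diag_apply, symPow_of_lower_left_eq_zero n h10, h00, h11]

lemma sum_range_pow_mul_pow_eq_chebyshev {a d : ℂ} (h : a * d = 1) (N : ℕ) :
    ∑ k ∈ Finset.range (N + 1), a ^ k * d ^ (N - k) =
      (Polynomial.Chebyshev.U ℂ N).eval ((a + d) / 2) := by
  have hrec : ∀ N : ℕ, ∑ k ∈ Finset.range (N + 2), a ^ k * d ^ (N + 1 - k) =
      d * ∑ k ∈ Finset.range (N + 1), a ^ k * d ^ (N - k) + a ^ (N + 1) := by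
    intro N
    rw [Finset.sum_range_succ, Finset.mul_sum, Nat.sub_self, pow_zero, mul_one]
    congr 1
    refine Finset.sum_congr rfl fun k hk => ?_
    have := Finset.mem_range.mp hk
    rw [show N + 1 - k = (N - k) + 1 by omega]
    ring
  induction N using Nat.twoStepInduction with
  | zero => simp
  | one =>
    simp [Finset.sum_range_succ]
    ring
  | more N ih1 ih2 =>
    have h1 := hrec N
    rw [hrec (N + 1)]
    push_cast at ih2 ⊢
    rw [Polynomial.Chebyshev.U_add_two]
    simp only [Polynomial.eval_sub, Polynomial.eval_mul, Polynomial.eval_ofNat, Polynomial.eval_X,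
      ← ih1, ← ih2, h1]
    linear_combination (-∑ k ∈ Finset.range (N + 1), a ^ k * d ^ (N - k)) * h

/-! ### The spin representations of `SU(2)` -/

/-- The norm of `x ^ k y ^ (n - k)`. -/
def weightNorm (n k : ℕ) : ℂ := (Real.sqrt ((k.factorial * (n - k).factorial : ℕ) : ℝ) : ℂ)

lemma weightNorm_ne_zero (n k : ℕ) : weightNorm n k ≠ 0 := by
  rw [weightNorm, Complex.ofReal_ne_zero, Real.sqrt_ne_zero']
  exact_mod_cast Nat.mul_pos (Nat.factorial_pos _) (Nat.factorial_pos _)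

lemma weightNorm_mul_self (n k : ℕ) :
    weightNorm n k * weightNorm n k = (k.factorial * (n - k).factorial : ℕ) := by
  rw [weightNorm, ← Complex.ofReal_mul, Real.mul_self_sqrt (by positivity)]
  simp

lemma star_weightNorm (n k : ℕ) : star (weightNorm n k) = weightNorm n k :=
  Complex.conj_ofReal _

lemma spinMatrix_apply (n : ℕ) (g : SU2) (k l : Fin (n + 1)) :
    spinMatrix (n + 1) g k l = weightNorm n k / weightNorm n l * symPow n g.1 k l := by
  simp [spinMatrix, symPow, weightNorm]

lemma spinMatrix_mul (N : ℕ) (g h : SU2) :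
    spinMatrix N (g * h) = spinMatrix N g * spinMatrix N h := by
  rcases N with _ | n
  · exact Subsingleton.elim _ _
  ext k l
  simp only [Matrix.mul_apply, spinMatrix_apply, Submonoid.coe_mul, symPow_mul, Finset.mul_sum]
  refine Finset.sum_congr rfl fun m _ => ?_
  have := weightNorm_ne_zero n m
  field_simp

lemma spinMatrix_one (N : ℕ) : spinMatrix N 1 = 1 := by
  rcases N with _ | n
  · exact Subsingleton.elim _ _
  ext k l
  rw [spinMatrix_apply, OneMemClass.coe_one, symPow_one]
  rcases eq_or_ne k l with rfl | h
  · rw [Matrix.one_apply_eq, mul_one, div_self (weightNorm_ne_zero n k)]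
  · simp [Matrix.one_apply_ne h]

/-- Since `C(n, k) k! (n-k)! = n!` does not depend on `k`, the normalization of the weight basis
turns the binomial symmetry `choose_mul_symPow` into unitarity. -/
lemma spinMatrix_inv (N : ℕ) (g : SU2) :
    spinMatrix N g⁻¹ = (spinMatrix N g).conjTranspose := by
  rcases N with _ | n
  · exact Subsingleton.elim _ _
  ext l k
  rw [Matrix.conjTranspose_apply, spinMatrix_apply, spinMatrix_apply, star_mul', star_div₀,
    star_weightNorm, star_weightNorm, symPow_conj]
  have h1 : (g⁻¹ : SU2).1 = (g.1.map star).transpose := rfl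
  have h2 := choose_mul_symPow n (g.1.map star) k l
  rw [h1]
  have hc : ∀ k : Fin (n + 1), (n.choose k : ℂ) * (weightNorm n k * weightNorm n k) =
      (n.factorial : ℂ) := by
    intro k
    rw [weightNorm_mul_self, ← Nat.choose_mul_factorial_mul_factorial (Nat.lt_succ_iff.mp k.2)]
    push_cast
    ring
  have hk := weightNorm_ne_zero n k
  have hl := weightNorm_ne_zero n l
  have hn : (n.factorial : ℂ) ≠ 0 := by exact_mod_cast n.factorial_ne_zero
  field_simp
  apply mul_left_cancel₀ hn
  rw [← hc k]
  have e := hc l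
  rw [← hc k] at e
  have hck : (n.choose k : ℂ) ≠ 0 := fun h => hn (by rw [← hc k, h, zero_mul])
  apply mul_left_cancel₀ hck
  linear_combination (-(n.choose k : ℂ) * weightNorm n k ^ 2 * weightNorm n l ^ 2) * h2 +
    n.choose k * weightNorm n k ^ 2 * symPow n (g.1.map star) k l * e

lemma conjTranspose_mul_spinMatrix (N : ℕ) (g : SU2) :
    (spinMatrix N g).conjTranspose * spinMatrix N g = 1 := by
  rw [← spinMatrix_inv, ← spinMatrix_mul, inv_mul_cancel, spinMatrix_one]

lemma continuous_spinMatrix (N : ℕ) (k l : Fin N) : Continuous fun g => spinMatrix N g k l := by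
  have hcoe : ∀ i j, Continuous fun g : SU2 => g.1 i j := fun i j =>
    continuous_subtype_val.matrix_elem i j
  have hmul : ∀ p q : SU2 → Polynomial ℂ, (∀ m, Continuous fun g => (p g).coeff m) →
      (∀ m, Continuous fun g => (q g).coeff m) → ∀ m, Continuous fun g => (p g * q g).coeff m := by
    intro p q hp hq m
    simp only [Polynomial.coeff_mul]
    exact continuous_finsetSum _ fun i _ => (hp _).mul (hq _)
  have hpow : ∀ p : SU2 → Polynomial ℂ, (∀ m, Continuous fun g => (p g).coeff m) →
      ∀ r m, Continuous fun g => (p g ^ r).coeff m := by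
    intro p hp r
    induction r with
    | zero => simpa using fun m => continuous_const
    | succ r ih => simpa only [pow_succ] using hmul _ _ ih hp
  have hlin : ∀ i j i' j' m, Continuous fun g : SU2 =>
      (Polynomial.C (g.1 i j) * Polynomial.X + Polynomial.C (g.1 i' j')).coeff m := by
    intro i j i' j' m
    simp only [Polynomial.coeff_add, Polynomial.coeff_C_mul, Polynomial.coeff_C]
    refine ((hcoe i j).mul continuous_const).add ?_
    split_ifs
    · exact hcoe i' j'
    · exact continuous_const
  simp only [spinMatrix, Matrix.of_apply]
  exact continuous_const.mul (hmul _ _ (hpow _ (hlin _ _ _ _) _) (hpow _ (hlin _ _ _ _) _) _)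

lemma trace_spinMatrix (N : ℕ) (g : SU2) (θ : ℝ)
    (h : Matrix.trace g.1 = ((2 * Real.cos θ : ℝ) : ℂ)) :
    (spinMatrix N g).trace = ((Polynomial.Chebyshev.U ℝ (N - 1)).eval (Real.cos θ) : ℝ) := by
  rcases N with _ | n
  -- The empty trace agrees with `U_{-1} = 0`; the index of `U` is an integer.
  · simp
  have htr : (spinMatrix (n + 1) g).trace = (symPow n g.1).trace := by
    refine Finset.sum_congr rfl fun k _ => ?_
    rw [Matrix.diag_apply, spinMatrix_apply, div_self (weightNorm_ne_zero n k), one_mul,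
      Matrix.diag_apply]
  have hexp : Complex.exp (θ * Complex.I) * Complex.exp (-θ * Complex.I) = 1 := by
    rw [← Complex.exp_add]
    simp
  have hcos : Complex.exp (θ * Complex.I) + Complex.exp (-θ * Complex.I) =
      2 * Complex.cos θ := by
    rw [Complex.cos]
    ring
  rw [htr, trace_symPow n g.1 (a := Complex.exp (θ * Complex.I)) (d := Complex.exp (-θ * Complex.I)),
    sum_range_pow_mul_pow_eq_chebyshev hexp, hcos, Polynomial.Chebyshev.complex_ofReal_eval_U]
  · simp
  · rw [h, hcos]
    push_cast
    rfl
  · rw [hexp]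
    exact (Matrix.mem_specialUnitaryGroup_iff.mp g.2).2

/-! ### Schur orthogonality -/

/-- The element of `SU(2)` with first column `(a, b)`. -/
def ofColumn (a b : ℂ) (h : star a * a + star b * b = 1) : SU2 :=
  ⟨!![a, -star b; b, star a], by
    rw [Matrix.mem_specialUnitaryGroup_iff, Matrix.mem_unitaryGroup_iff']
    constructor
    · ext i j
      fin_cases i <;> fin_cases j <;>
        simp [Matrix.mul_apply, Fin.sum_univ_two, Matrix.star_apply] <;>
        simp at h <;> first | linear_combination h | ring
    · simp [Matrix.det_fin_two]
      simp at h
      linear_combination h⟩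

/-- The last column holds the coefficients of `(a x + c y) ^ n`: binomial coefficients times powers
of `a` and `c`. -/
lemma spinMatrix_last_ne_zero (n : ℕ) {g : SU2} (h0 : g.1 0 0 ≠ 0) (h1 : g.1 1 0 ≠ 0)
    (k : Fin (n + 1)) : spinMatrix (n + 1) g k (Fin.last n) ≠ 0 := by
  have hp : (Polynomial.C (g.1 0 0) * Polynomial.X + Polynomial.C (g.1 1 0)) ^ n =
      Polynomial.C (g.1 0 0 ^ n) * (Polynomial.X + Polynomial.C (g.1 1 0 / g.1 0 0)) ^ n := by
    rw [map_pow, ← mul_pow, mul_add, ← map_mul, mul_div_cancel₀ _ h0]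
  rw [spinMatrix_apply]
  refine mul_ne_zero (div_ne_zero (weightNorm_ne_zero _ _) (weightNorm_ne_zero _ _)) ?_
  simp only [symPow, Matrix.of_apply, Fin.val_last, Nat.sub_self, pow_zero, mul_one]
  rw [hp, Polynomial.coeff_C_mul, Polynomial.coeff_X_add_C_pow]
  refine mul_ne_zero (pow_ne_zero _ h0) (mul_ne_zero (pow_ne_zero _ (div_ne_zero h1 h0)) ?_)
  exact_mod_cast (Nat.choose_pos (Nat.lt_succ_iff.mp k.2)).ne'

lemma exists_spinMatrix_last_ne_zero :
    ∃ g : SU2, ∀ (n : ℕ) (k : Fin (n + 1)), spinMatrix (n + 1) g k (Fin.last n) ≠ 0 ∧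
      spinMatrix (n + 1) g (Fin.last n) k ≠ 0 := by
  -- Any unit column with two nonzero entries would do. The last row is read off from the last
  -- column of the inverse.
  refine ⟨ofColumn (3 / 5) (4 / 5) (by norm_num [Complex.ext_iff]), fun n k => ⟨?_, ?_⟩⟩
  · exact spinMatrix_last_ne_zero n (by simp [ofColumn]) (by simp [ofColumn]) k
  · rw [← inv_inv (ofColumn _ _ _), spinMatrix_inv, Matrix.conjTranspose_apply, star_ne_zero]
    refine spinMatrix_last_ne_zero n ?_ ?_ k
    · change star (ofColumn _ _ _).1 0 0 ≠ 0
      simp [ofColumn, Matrix.star_apply]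
    · change star (ofColumn _ _ _).1 1 0 ≠ 0
      simp [ofColumn, Matrix.star_apply]

/-- The weight of the `k`-th vector of the weight basis of dimension `N`, doubled. -/
def weight (N k : ℕ) : ℤ := 2 * k - (N - 1)

lemma exists_spinMatrix_eq_diagonal :
    ∃ t : SU2, ∀ N, spinMatrix N t = Matrix.diagonal fun k : Fin N =>
      Complex.exp (weight N k * Complex.I) := by
  have hI : star (Complex.exp Complex.I) = Complex.exp (-Complex.I) := by
    simp [← Complex.exp_conj]
  refine ⟨ofColumn (Complex.exp Complex.I) 0 ?_, fun N => ?_⟩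
  · rw [hI, ← Complex.exp_add]
    simp
  rcases N with _ | n
  · exact Subsingleton.elim _ _
  have ht : (ofColumn (Complex.exp Complex.I) 0 (by rw [hI, ← Complex.exp_add]; simp)).1 =
      Matrix.diagonal ![Complex.exp Complex.I, Complex.exp (-Complex.I)] := by
    ext i j
    fin_cases i <;> fin_cases j <;> simp [ofColumn, ← hI]
  ext k l
  rw [spinMatrix_apply, ht, symPow_diagonal]
  rcases eq_or_ne k l with rfl | h
  · rw [Matrix.diagonal_apply_eq, Matrix.diagonal_apply_eq, div_self (weightNorm_ne_zero _ _),
      one_mul, ← Complex.exp_nat_mul, ← Complex.exp_nat_mul, ← Complex.exp_add,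
      Nat.cast_sub (Nat.lt_succ_iff.mp k.2), weight]
    congr 1
    push_cast
    ring
  · rw [Matrix.diagonal_apply_ne _ h, Matrix.diagonal_apply_ne _ h, mul_zero]

/-- Because `π` is irrational, the torus element of angle one radian alone separates all weights. -/
lemma exp_int_mul_I_injective :
    Function.Injective fun m : ℤ => Complex.exp (m * Complex.I) := by
  intro m m' h
  obtain ⟨r, hr⟩ := Complex.exp_eq_exp_iff_exists_int.mp h
  have h1 : ((m : ℝ) : ℂ) = ((m' + r * (2 * Real.pi) : ℝ) : ℂ) := by
    apply mul_right_cancel₀ Complex.I_ne_zero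
    push_cast
    linear_combination hr
  have h2 := Complex.ofReal_injective h1
  by_cases hr0 : r = 0
  · rw [hr0] at h2
    exact_mod_cast (by simpa using h2 : (m : ℝ) = m')
  · exfalso
    refine (irrational_pi.ne_rat ((m - m' : ℤ) / (2 * r : ℤ))) ?_
    have : (r : ℝ) ≠ 0 := by exact_mod_cast hr0
    push_cast
    field_simp
    linarith

variable {N N' : ℕ}

lemma weight_eq_of_intertwiner {P : Matrix (Fin N') (Fin N) ℂ}
    (hP : ∀ h, spinMatrix N' h * P = P * spinMatrix N h) {k' : Fin N'} {k : Fin N}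
    (hk : P k' k ≠ 0) : weight N' k' = weight N k := by
  obtain ⟨t, ht⟩ := exists_spinMatrix_eq_diagonal
  have h1 := congrFun (congrFun (hP t) k') k
  rw [ht, ht, Matrix.diagonal_mul, Matrix.mul_diagonal, mul_comm] at h1
  exact exp_int_mul_I_injective (mul_left_cancel₀ hk h1)

/-- The highest weight of the larger representation does not occur in the smaller one, so the last
row of `P` vanishes. A nonzero entry `P k' k` is alone in its column, and a group element whose last
row has no zero would carry it into the last row. -/
lemma intertwiner_eq_zero_of_lt {P : Matrix (Fin N') (Fin N) ℂ}
    (hP : ∀ h, spinMatrix N' h * P = P * spinMatrix N h) (hN : N < N') : P = 0 := by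
  obtain ⟨n', rfl⟩ : ∃ n', N' = n' + 1 := ⟨N' - 1, by omega⟩
  obtain ⟨h, hh⟩ := exists_spinMatrix_last_ne_zero
  ext k' k
  by_contra hk
  have hw := weight_eq_of_intertwiner hP hk
  have h1 := congrFun (congrFun (hP h) (Fin.last n')) k
  rw [Matrix.mul_apply, Matrix.mul_apply, Finset.sum_eq_single k', Finset.sum_eq_zero] at h1
  · exact mul_ne_zero (hh n' k').2 hk h1
  · intro m _
    by_contra hm
    have := weight_eq_of_intertwiner hP (left_ne_zero_of_mul hm)
    have hm2 := m.2
    simp only [weight, Fin.val_last] at this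
    omega
  · intro m _ hm
    by_contra hm0
    have := weight_eq_of_intertwiner hP (right_ne_zero_of_mul hm0)
    refine hm (Fin.ext ?_)
    simp only [weight] at this hw
    omega
  · simp

lemma intertwiner_eq_zero {P : Matrix (Fin N') (Fin N) ℂ}
    (hP : ∀ h, spinMatrix N' h * P = P * spinMatrix N h) (hN : N ≠ N') : P = 0 := by
  rcases hN.lt_or_gt with hN | hN
  · exact intertwiner_eq_zero_of_lt hP hN
  -- By unitarity the adjoint of an intertwiner is an intertwiner in the opposite direction.
  · refine Matrix.conjTranspose_eq_zero.mp (intertwiner_eq_zero_of_lt (fun h => ?_) hN)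
    have h1 := congrArg Matrix.conjTranspose (hP h⁻¹)
    simpa [spinMatrix_inv] using h1.symm

/-- Weights are simple, so `P` is diagonal; commuting with a matrix whose last column has no zero
makes all diagonal entries equal to the last. -/
lemma intertwiner_eq_scalar {P : Matrix (Fin N) (Fin N) ℂ}
    (hP : ∀ h, spinMatrix N h * P = P * spinMatrix N h) : ∃ c : ℂ, P = c • 1 := by
  rcases N with _ | n
  · exact ⟨0, Subsingleton.elim _ _⟩
  obtain ⟨h, hh⟩ := exists_spinMatrix_last_ne_zero
  have hoff : ∀ k l, k ≠ l → P k l = 0 := by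
    intro k l hkl
    by_contra h0
    have := weight_eq_of_intertwiner hP h0
    refine hkl (Fin.ext ?_)
    simp only [weight] at this
    omega
  refine ⟨P (Fin.last n) (Fin.last n), ?_⟩
  ext k l
  rcases eq_or_ne k l with rfl | hkl
  · have h1 := congrFun (congrFun (hP h) k) (Fin.last n)
    rw [Matrix.mul_apply, Matrix.mul_apply, Finset.sum_eq_single (Fin.last n),
      Finset.sum_eq_single k, mul_comm] at h1
    · simpa using (mul_right_cancel₀ (hh n k).1 h1).symm
    · intro m _ hm
      rw [hoff _ _ hm.symm, zero_mul]
    · simp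
    · intro m _ hm
      rw [hoff _ _ hm, mul_zero]
    · simp
  · simp [hoff k l hkl, Matrix.one_apply_ne hkl]

open MeasureTheory

/-- The normalized invariant measure of `SU(2)`. -/
abbrev haarSU2 : Measure SU2 := Measure.haarMeasure ⊤

instance : IsProbabilityMeasure haarSU2 :=
  ⟨by simpa using Measure.haarMeasure_self (K₀ := (⊤ : TopologicalSpace.PositiveCompacts SU2))⟩

lemma integrable_of_continuous {f : SU2 → ℂ} (hf : Continuous f) : Integrable f haarSU2 :=
  hf.integrable_of_hasCompactSupport (HasCompactSupport.of_compactSpace f)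

lemma continuous_star_spinMatrix_mul (k l : Fin N) (k' l' : Fin N') :
    Continuous fun g => star (spinMatrix N g k l) * spinMatrix N' g k' l' :=
  (continuous_spinMatrix N k l).star.mul (continuous_spinMatrix N' k' l')

/-- Left invariance of the Haar measure under `g ↦ h⁻¹ g`, combined with unitarity. -/
lemma averaged_intertwiner (l : Fin N) (l' : Fin N') (h : SU2) :
    spinMatrix N' h * (Matrix.of fun k' k => ∫ g, star (spinMatrix N g k l) *
        spinMatrix N' g k' l' ∂haarSU2) =
      (Matrix.of fun k' k => ∫ g, star (spinMatrix N g k l) *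
        spinMatrix N' g k' l' ∂haarSU2) * spinMatrix N h := by
  ext k' k
  simp only [Matrix.mul_apply, Matrix.of_apply, ← integral_const_mul, ← integral_mul_const]
  rw [← integral_finsetSum _ fun m _ =>
      (integrable_of_continuous (continuous_star_spinMatrix_mul k l m l')).const_mul _,
    ← integral_finsetSum _ fun m _ =>
      (integrable_of_continuous (continuous_star_spinMatrix_mul m l k' l')).mul_const _,
    ← integral_mul_left_eq_self _ h⁻¹]
  refine integral_congr_ae (Filter.Eventually.of_forall fun g => ?_)
  have h1 : spinMatrix N' g k' l' =
      ∑ m, spinMatrix N' h k' m * spinMatrix N' (h⁻¹ * g) m l' := by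
    rw [← Matrix.mul_apply, ← spinMatrix_mul, mul_inv_cancel_left]
  have h2 : star (spinMatrix N (h⁻¹ * g) k l) =
      ∑ m, star (spinMatrix N g m l) * spinMatrix N h m k := by
    rw [spinMatrix_mul, spinMatrix_inv, Matrix.mul_apply, star_sum]
    refine Finset.sum_congr rfl fun m _ => ?_
    rw [Matrix.conjTranspose_apply, star_mul', star_star, mul_comm]
  calc ∑ m, spinMatrix N' h k' m *
        (star (spinMatrix N (h⁻¹ * g) k l) * spinMatrix N' (h⁻¹ * g) m l')
      = star (spinMatrix N (h⁻¹ * g) k l) * spinMatrix N' g k' l' := by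
        rw [h1, Finset.mul_sum]
        exact Finset.sum_congr rfl fun _ _ => by ring
    _ = ∑ m, star (spinMatrix N g m l) * spinMatrix N' g k' l' * spinMatrix N h m k := by
        rw [h2, Finset.sum_mul]
        exact Finset.sum_congr rfl fun _ _ => by ring

/-- Schur orthogonality for `SU(2)`. -/
theorem integral_star_spinMatrix_mul (k l : Fin N) (k' l' : Fin N') :
    ∫ g, star (spinMatrix N g k l) * spinMatrix N' g k' l' ∂haarSU2 =
      if N = N' ∧ (k : ℕ) = k' ∧ (l : ℕ) = l' then 1 / (N : ℂ) else 0 := by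
  have hP := averaged_intertwiner l l'
  set P : Matrix (Fin N') (Fin N) ℂ := Matrix.of fun k' k => ∫ g, star (spinMatrix N g k l) *
    spinMatrix N' g k' l' ∂haarSU2 with hPdef
  change P k' k = _
  rcases eq_or_ne N N' with rfl | hN
  · obtain ⟨c, hc⟩ := intertwiner_eq_scalar hP
    -- The scalar is found from the trace, whose integrand is an entry of the constant matrix `U* U
    -- = 1`.
    have htr : N * c = if l = l' then 1 else 0 := by
      calc N * c = P.trace := by simp [hc, mul_comm]
        _ = ∫ g, ((spinMatrix N g).conjTranspose * spinMatrix N g) l l' ∂haarSU2 := by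
          simp only [Matrix.mul_apply, Matrix.conjTranspose_apply]
          rw [integral_finsetSum _ fun m _ =>
            integrable_of_continuous (continuous_star_spinMatrix_mul m l m l')]
          rfl
        _ = _ := by simp [conjTranspose_mul_spinMatrix, Matrix.one_apply]
    have hN : (N : ℂ) ≠ 0 := by
      have := k.pos
      exact_mod_cast this.ne'
    have hc' : c = if l = l' then 1 / (N : ℂ) else 0 := by
      rw [eq_comm, ← mul_right_inj' hN, htr]
      split_ifs <;> field_simp
      simp
    simp only [hc, Matrix.smul_apply, Matrix.one_apply, hc', Fin.val_inj, true_and, smul_eq_mul]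
    grind
  · rw [intertwiner_eq_zero hP hN]
    simp [hN]

/-! ### Computations in the Grassmann algebra -/

lemma eta_mul_eta : eta * eta = 0 := by
  rw [eta, ← map_mul, Algebra.TensorProduct.tmul_mul_tmul, ExteriorAlgebra.ι_sq_zero,
    TensorProduct.tmul_zero, map_zero]

lemma etaBar_mul_etaBar : etaBar * etaBar = 0 := by
  rw [etaBar, ← map_mul, Algebra.TensorProduct.tmul_mul_tmul, ExteriorAlgebra.ι_sq_zero,
    TensorProduct.tmul_zero, map_zero]

lemma eta_mul_etaBar : eta * etaBar = -(etaBar * eta) := by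
  rw [eta, etaBar, ← map_mul, ← map_mul, ← map_neg, Algebra.TensorProduct.tmul_mul_tmul,
    Algebra.TensorProduct.tmul_mul_tmul, ← TensorProduct.tmul_neg,
    eq_neg_of_add_eq_zero_left (ExteriorAlgebra.ι_add_mul_swap _ _)]

lemma etaBar_mul_eta_mul_self : etaBar * eta * (etaBar * eta) = 0 := by
  rw [mul_assoc, ← mul_assoc eta, eta_mul_etaBar, neg_mul, mul_assoc, eta_mul_eta]
  simp

lemma grConj_eta : grConj eta = etaBar := by
  simp only [grConj, eta, etaBar, RingHom.comp_apply, RingHom.coe_coe, AlgEquiv.symm_apply_apply,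
    Algebra.TensorProduct.map_tmul, ExteriorAlgebra.map_apply_ι]
  congr 3
  · simp
  · ext i
    fin_cases i <;> simp [Matrix.toLin'_apply]

lemma grConj_etaBar : grConj etaBar = -eta := by
  simp only [grConj, eta, etaBar, RingHom.comp_apply, RingHom.coe_coe, AlgEquiv.symm_apply_apply,
    Algebra.TensorProduct.map_tmul, ExteriorAlgebra.map_apply_ι]
  rw [← map_neg, ← TensorProduct.tmul_neg, ← map_neg]
  congr 3
  · simp
  · ext i
    fin_cases i <;> simp [Matrix.toLin'_apply]

lemma grConj_algebraMap (c : ℂ) :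
    grConj (algebraMap ℂ Grassmann c) = algebraMap ℂ Grassmann (star c) := by
  have h : ∀ c : ℂ, algebraMap ℂ Grassmann c = ofTensor (c ⊗ₜ[ℝ] 1) := fun c => by
    rw [← ofTensor.commutes]
    rfl
  rw [h, h, grConj]
  simp

lemma grConj_smul (c : ℂ) (x : Grassmann) : grConj (c • x) = star c • grConj x := by
  rw [Algebra.smul_def, map_mul, grConj_algebraMap, ← Algebra.smul_def]

lemma grConj_etaBar_mul_eta : grConj (etaBar * eta) = etaBar * eta := by
  rw [map_mul, grConj_etaBar, grConj_eta, neg_mul, eta_mul_etaBar, neg_neg]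

/-- The Berezin integral as a linear functional. -/
def berezinLM : Grassmann →ₗ[ℂ] ℂ := body.toLinearMap ∘ₗ oddDeriv 1 ∘ₗ oddDeriv 0

lemma berezinLM_apply (x : Grassmann) : berezinLM x = berezin x := rfl

lemma berezin_one : berezin 1 = 0 := by
  have h : oddDeriv 0 1 = 0 := by
    simp [oddDeriv, Algebra.TensorProduct.one_def]
  simp [berezin, h]

lemma berezin_etaBar_mul_eta : berezin (etaBar * eta) = -1 := by
  -- The sign arises because the left derivative in `η` has to pass `η̄`.
  have h0 : oddDeriv 0 (etaBar * eta) = -etaBar := by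
    rw [etaBar, eta, ← map_mul, Algebra.TensorProduct.tmul_mul_tmul]
    simp [oddDeriv, ExteriorAlgebra.ι, CliffordAlgebra.contractLeft_ι_mul]
    rw [TensorProduct.tmul_neg, map_neg]
  have h1 : oddDeriv 1 etaBar = 1 := by
    rw [etaBar]
    simp [oddDeriv, ExteriorAlgebra.ι, ← Algebra.TensorProduct.one_def]
  rw [berezin, h0, map_neg, h1, map_neg, map_one]

/-- The even element `1 + α η̄η`. -/
def evenElt (α : ℝ) : Grassmann := 1 + (α : ℂ) • (etaBar * eta)

lemma grConj_evenElt (α : ℝ) : grConj (evenElt α) = evenElt α := by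
  rw [evenElt, map_add, map_one, grConj_smul, grConj_etaBar_mul_eta]
  simp

/-- As `(η̄η)² = 0`, the element `1 + α η̄η` behaves as an exponential in `α`. -/
lemma evenElt_mul (α β : ℝ) : evenElt α * evenElt β = evenElt (α + β) := by
  simp only [evenElt, mul_add, add_mul, one_mul, mul_one, smul_mul_assoc, mul_smul_comm,
    etaBar_mul_eta_mul_self, smul_zero, add_zero, Complex.ofReal_add, add_smul]
  abel

lemma berezin_evenElt (α : ℝ) : berezin (evenElt α) = -α := by
  rw [← berezinLM_apply, evenElt, map_add, map_smul, berezinLM_apply, berezinLM_apply, berezin_one,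
    berezin_etaBar_mul_eta]
  simp

/-- The fibre integral as a linear functional. -/
def fibreLM : Grassmann →ₗ[ℂ] ℂ := berezinLM ∘ₗ LinearMap.mulLeft ℂ (evenElt (-(1 / 4)))

lemma fibreIntegral_eq (f : SU2 → Grassmann) (g : SU2) : fibreIntegral f g = fibreLM (f g) := by
  have : (1 - (1 / 4 : ℂ) • (etaBar * eta)) = evenElt (-(1 / 4)) := by
    simp [evenElt, sub_eq_add_neg]
  rw [fibreIntegral, this]
  rfl

lemma fibreLM_evenElt (α : ℝ) : fibreLM (evenElt α) = 1 / 4 - α := by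
  change berezin (evenElt _ * evenElt α) = _
  rw [evenElt_mul, berezin_evenElt]
  push_cast
  ring

/-! ### The irreducible representations in closed form -/

/-- Complex matrix entries pass Grassmann scalars without a sign. The only signs come from `η η̄ =
-η̄ η`, which is why the square of the odd exponent contains the commutator of `V₊` and `V₋`. -/
lemma smul_toGr_mul_smul_toGr (n : ℕ) (x y : Grassmann) (M N : Matrix (Idx n) (Idx n) ℂ) :
    (x • toGr n M) * (y • toGr n N) = (x * y) • toGr n (M * N) := by
  ext a b
  simp only [Matrix.mul_apply, Matrix.smul_apply, smul_eq_mul, toGr, Matrix.map_apply, map_sum,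
    map_mul, Finset.mul_sum]
  refine Finset.sum_congr rfl fun c _ => ?_
  rw [mul_assoc, ← mul_assoc _ y, Algebra.commutes (M a c) y]
  simp only [mul_assoc]

lemma sum_ite_eq_mul_ite_eq {N : ℕ} (k l : ℕ) (f : ℕ → ℂ) (c : ℂ) :
    ∑ m : Fin N, (if k = (m : ℕ) then f m else 0) * (if (m : ℕ) = l then c else 0) =
      if k = l ∧ k < N then f k * c else 0 := by
  have : ∀ m, (if k = m then f m else 0) * (if m = l then c else 0) =
      if k = m then (if k = l then f k * c else 0) else 0 := by grind
  simp only [this]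
  rw [Fin.sum_univ_eq_sum_range (fun m => if k = m then (if k = l then f k * c else 0) else 0) N,
    Finset.sum_ite_eq]
  grind

lemma sum_ite_eq_succ_mul_ite_succ_eq {N : ℕ} (k l : ℕ) (f : ℕ → ℂ) (c : ℂ) :
    ∑ m : Fin N, (if k = (m : ℕ) + 1 then f m else 0) * (if (m : ℕ) + 1 = l then c else 0) =
      if k = l ∧ 0 < k ∧ k ≤ N then f (k - 1) * c else 0 := by
  rcases k with _ | k
  · simp
  · rcases l with _ | l
    · simp
    · simp only [add_left_inj, sum_ite_eq_mul_ite_eq, Nat.add_sub_cancel]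
      grind

lemma vPlus_mul_vMinus_sub (n : ℕ) : vPlus n * vMinus n - vMinus n * vPlus n =
    Matrix.fromBlocks ((-(n / 4) : ℂ) • 1) 0 0 (((n + 1) / 4 : ℂ) • 1) := by
  have hs : ∀ (a b x : ℝ), 0 ≤ x → ((a * Real.sqrt x : ℝ) : ℂ) * (b * Real.sqrt x : ℝ) =
      (a * b * x : ℝ) := fun a b x hx => by
    rw [← Complex.ofReal_mul, mul_mul_mul_comm, Real.mul_self_sqrt hx]
  rw [vPlus, vMinus, Matrix.fromBlocks_multiply, Matrix.fromBlocks_multiply]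
  simp only [Matrix.zero_mul, Matrix.mul_zero, zero_add, add_zero]
  ext (k | k) (l | l)
  · simp only [Matrix.sub_apply, Matrix.fromBlocks_apply₁₁, Matrix.mul_apply, Matrix.of_apply]
    rw [sum_ite_eq_succ_mul_ite_succ_eq k l
        (fun m => ((-(1 / 2) * Real.sqrt ((m : ℝ) + 1) : ℝ) : ℂ)),
      sum_ite_eq_mul_ite_eq k l (fun m => ((-(1 / 2) * Real.sqrt ((n : ℝ) - m) : ℝ) : ℂ))]
    rcases eq_or_ne k l with rfl | h
    · have hkn : ((k : ℕ) : ℝ) ≤ n := by exact_mod_cast Nat.lt_succ_iff.mp k.2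
      -- The range conditions here and in `e2` exclude only `k = 0` and `k = n` respectively, where
      -- the square roots vanish anyway.
      have e1 : (if (k : ℕ) = k ∧ 0 < (k : ℕ) ∧ (k : ℕ) ≤ n then
          ((-(1 / 2) * Real.sqrt (((k - 1 : ℕ) : ℝ) + 1) : ℝ) : ℂ) *
            ((1 / 2 * Real.sqrt (k : ℕ) : ℝ) : ℂ) else 0) = (-(1 / 2) * (1 / 2) * (k : ℕ) : ℝ) := by
        rcases Nat.eq_zero_or_pos (k : ℕ) with hk | hk
        · simp [hk]
        · rw [if_pos ⟨rfl, hk, Nat.lt_succ_iff.mp k.2⟩, ← Nat.cast_add_one, Nat.sub_add_cancel hk,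
            hs _ _ _ (Nat.cast_nonneg _)]
      have e2 : (if (k : ℕ) = k ∧ (k : ℕ) < n then
          ((-(1 / 2) * Real.sqrt ((n : ℝ) - (k : ℕ)) : ℝ) : ℂ) *
            ((-(1 / 2) * Real.sqrt ((n : ℝ) - (k : ℕ)) : ℝ) : ℂ) else 0) =
          (-(1 / 2) * -(1 / 2) * (n - (k : ℕ)) : ℝ) := by
        rcases hkn.eq_or_lt with hk | hk
        · simp [hk]
        · rw [if_pos ⟨rfl, by exact_mod_cast hk⟩, hs _ _ _ (sub_nonneg.mpr hkn)]
      rw [e1, e2]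
      simp
      ring
    · simp [h, Fin.val_inj]
  · simp
  · simp
  · simp only [Matrix.sub_apply, Matrix.fromBlocks_apply₂₂, Matrix.mul_apply, Matrix.of_apply]
    rw [sum_ite_eq_mul_ite_eq k l (fun m => ((-(1 / 2) * Real.sqrt ((n : ℝ) - m) : ℝ) : ℂ)),
      sum_ite_eq_mul_ite_eq (k + 1) (l + 1) (fun m => ((1 / 2 * Real.sqrt m : ℝ) : ℂ))]
    have hk := k.2
    rcases eq_or_ne k l with rfl | h
    · have hkn : ((k : ℕ) : ℝ) ≤ n := by exact_mod_cast hk.le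
      rw [if_pos ⟨rfl, by omega⟩, if_pos ⟨rfl, by omega⟩, hs _ _ _ (sub_nonneg.mpr hkn),
        Nat.cast_add_one, hs _ _ _ (by positivity)]
      simp
      ring
    · simp [h, Fin.val_inj]

lemma irrep_eq (n : ℕ) (g : SU2) : irrep n g =
    toGr n (Matrix.fromBlocks (spinMatrix (n + 1) g) 0 0 (spinMatrix n g)) *
      (1 + (etaBar • toGr n (vPlus n) + eta • toGr n (vMinus n)) + (1 / 2 : ℂ) •
        ((etaBar * eta) • toGr n (vPlus n * vMinus n - vMinus n * vPlus n))) := by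
  have h2 : (etaBar • toGr n (vPlus n) + eta • toGr n (vMinus n)) ^ 2 =
      (etaBar * eta) • toGr n (vPlus n * vMinus n - vMinus n * vPlus n) := by
    rw [pow_two, add_mul, mul_add, mul_add]
    simp only [smul_toGr_mul_smul_toGr, etaBar_mul_etaBar, eta_mul_eta, eta_mul_etaBar, zero_smul,
      zero_add, add_zero]
    ext a b
    simp only [Matrix.add_apply, Matrix.smul_apply, toGr, Matrix.map_apply, Matrix.sub_apply,
      map_sub, smul_eq_mul, mul_sub, neg_mul]
    rw [sub_eq_add_neg]
  have h3 : (etaBar • toGr n (vPlus n) + eta • toGr n (vMinus n)) ^ 3 = 0 := by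
    rw [pow_succ, h2, mul_add]
    simp only [smul_toGr_mul_smul_toGr, mul_assoc, eta_mul_eta, eta_mul_etaBar, mul_zero, zero_smul,
      add_zero, mul_neg, ← mul_assoc etaBar etaBar, etaBar_mul_etaBar, zero_mul, neg_zero]
  rw [irrep, IsNilpotent.exp_eq_sum h3]
  congr 1
  simp only [Finset.sum_range_succ, Finset.sum_range_zero, h2, zero_add, pow_zero, pow_one,
    Nat.factorial]
  congr 1
  · simp
  -- The exponential series carries the rational scalar `1/2!`, the claim a complex `1/2`; doubling
  -- removes both.
  · apply smul_right_injective _ (two_ne_zero (α := ℂ))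
    simp only [two_smul, ← add_smul]
    norm_num

lemma irrep_inl_inl (n : ℕ) (g : SU2) (k l : Fin (n + 1)) :
    irrep n g (Sum.inl k) (Sum.inl l) = spinMatrix (n + 1) g k l • evenElt (-(n / 8)) := by
  rw [irrep_eq, vPlus_mul_vMinus_sub, Matrix.mul_apply, Fintype.sum_sum_type,
    Finset.sum_eq_single l]
  · simp [toGr, vPlus, vMinus, evenElt]
    rw [← Algebra.commutes, ← Algebra.smul_def, ← Algebra.smul_def]
    module
  · intro m _ hm
    simp [toGr, vPlus, vMinus, hm]
  · simp

lemma irrep_inr_inr (n : ℕ) (g : SU2) (k l : Fin n) :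
    irrep n g (Sum.inr k) (Sum.inr l) = spinMatrix n g k l • evenElt ((n + 1) / 8) := by
  rw [irrep_eq, vPlus_mul_vMinus_sub, Matrix.mul_apply, Fintype.sum_sum_type,
    add_comm, Finset.sum_eq_single l]
  · simp [toGr, vPlus, vMinus, evenElt]
    rw [← Algebra.commutes, ← Algebra.smul_def, ← Algebra.smul_def]
    module
  · intro m _ hm
    simp [toGr, vPlus, vMinus, hm]
  · simp

/-! ### Integrability -/

/-- The superfunctions on `UOSp(1|2)` with continuous components. -/
def continuousSuperfunctions : Submodule ℂ (SU2 → Grassmann) :=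
  Submodule.span ℂ {f | ∃ (c : SU2 → ℂ) (x : Grassmann), Continuous c ∧ f = fun g => c g • x}

/-- The exponential factor does not depend on `g`, so each entry, in all four blocks, is a
combination of fixed Grassmann elements with continuous coefficients. -/
lemma coeffFun_mem (n : ℕ) (a b : Idx n) : coeffFun n a b ∈ continuousSuperfunctions := by
  set E := IsNilpotent.exp (etaBar • toGr n (vPlus n) + eta • toGr n (vMinus n)) with hE
  have h : coeffFun n a b = ∑ c, fun g =>
      Matrix.fromBlocks (spinMatrix (n + 1) g) 0 0 (spinMatrix n g) a c • E c b := by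
    ext g
    rw [coeffFun, irrep, ← hE, Matrix.mul_apply, Finset.sum_apply]
    simp only [toGr, Matrix.map_apply, Algebra.smul_def]
  rw [h]
  refine Submodule.sum_mem _ fun c _ => Submodule.subset_span ⟨_, _, ?_, rfl⟩
  rcases a with a | a <;> rcases c with c | c
  · exact continuous_spinMatrix _ _ _
  · exact continuous_const
  · exact continuous_const
  · exact continuous_spinMatrix _ _ _

lemma superChar_mem (n : ℕ) : superChar n ∈ continuousSuperfunctions := by
  have h : superChar n = ∑ k, coeffFun n (Sum.inl k) (Sum.inl k) -
      ∑ k, coeffFun n (Sum.inr k) (Sum.inr k) := by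
    ext g
    simp [superChar, superTrace, coeffFun]
  rw [h]
  exact Submodule.sub_mem _ (Submodule.sum_mem _ fun _ _ => coeffFun_mem _ _ _)
    (Submodule.sum_mem _ fun _ _ => coeffFun_mem _ _ _)

lemma continuous_fibreIntegral_grConj_mul {f h : SU2 → Grassmann}
    (hf : f ∈ continuousSuperfunctions) (hh : h ∈ continuousSuperfunctions) :
    Continuous (fibreIntegral fun g => grConj (f g) * h g) := by
  simp only [funext (fibreIntegral_eq _)]
  induction hf using Submodule.span_induction with
  | mem f hf =>
    obtain ⟨c, x, hc, rfl⟩ := hf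
    induction hh using Submodule.span_induction with
    | mem h hh =>
      obtain ⟨d, y, hd, rfl⟩ := hh
      simp only [grConj_smul, smul_mul_smul_comm, map_smul, smul_eq_mul]
      exact (hc.star.mul hd).mul continuous_const
    | zero => simpa using continuous_const
    | add h₁ h₂ _ _ ih₁ ih₂ => simpa [mul_add] using ih₁.fun_add ih₂
    | smul a h _ ih => simpa using continuous_const.fun_mul ih
  | zero => simpa using continuous_const
  | add h₁ h₂ _ _ ih₁ ih₂ => simpa [add_mul] using ih₁.fun_add ih₂
  | smul a h _ ih => simpa [grConj_smul] using (continuous_const (y := star a)).fun_mul ih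

lemma superIntegrable_grConj_mul {f h : SU2 → Grassmann}
    (hf : f ∈ continuousSuperfunctions) (hh : h ∈ continuousSuperfunctions) :
    SuperIntegrable fun g => grConj (f g) * h g :=
  (integrable_of_continuous (continuous_fibreIntegral_grConj_mul hf hh)).smul_measure
    (by simp)

/-! ### Super scalar products -/

lemma integral_sigma (f : SU2 → ℂ) : ∫ g, f g ∂sigma = 4 * ∫ g, f g ∂haarSU2 := by
  simp [sigma, integral_smul_measure]

lemma fibreLM_grConj_smul_evenElt_mul (c d : ℂ) (α β : ℝ) :
    fibreLM (grConj (c • evenElt α) * d • evenElt β) = star c * d * (1 / 4 - (α + β : ℝ)) := by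
  rw [grConj_smul, grConj_evenElt, smul_mul_smul_comm, evenElt_mul, map_smul, fibreLM_evenElt,
    smul_eq_mul]

/-- The fibre contributes `1/4 - (α + β)`, and the total mass `4` of `sigma` rescales it. -/
lemma superInner_smul_evenElt (u v : SU2 → ℂ) (α β : ℝ) :
    superInner (fun g => u g • evenElt α) (fun g => v g • evenElt β) =
      (1 - 4 * (α + β : ℝ)) * ∫ g, star (u g) * v g ∂haarSU2 := by
  simp only [superInner, superIntegral, fibreIntegral_eq, fibreLM_grConj_smul_evenElt_mul,
    integral_mul_const, integral_sigma]
  ring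

lemma coeffFun_inl_inl (n : ℕ) (k l : Fin (n + 1)) : coeffFun n (Sum.inl k) (Sum.inl l) =
    fun g => spinMatrix (n + 1) g k l • evenElt (-(n / 8)) :=
  funext fun g => irrep_inl_inl n g k l

lemma coeffFun_inr_inr (n : ℕ) (k l : Fin n) : coeffFun n (Sum.inr k) (Sum.inr l) =
    fun g => spinMatrix n g k l • evenElt ((n + 1) / 8) :=
  funext fun g => irrep_inr_inr n g k l

lemma superInner_inl_inl (n n' : ℕ) (k l : Fin (n + 1)) (k' l' : Fin (n' + 1)) :
    superInner (coeffFun n (Sum.inl k) (Sum.inl l)) (coeffFun n' (Sum.inl k') (Sum.inl l')) =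
      if n = n' ∧ (k : ℕ) = k' ∧ (l : ℕ) = l' then 1 else 0 := by
  rw [coeffFun_inl_inl, coeffFun_inl_inl, superInner_smul_evenElt, integral_star_spinMatrix_mul]
  simp only [add_left_inj]
  split_ifs with h
  · obtain ⟨rfl, -⟩ := h
    have : (n : ℂ) + 1 ≠ 0 := by exact_mod_cast n.succ_ne_zero
    push_cast
    field_simp
    ring
  · simp

lemma superInner_inr_inr (n n' : ℕ) (k l : Fin n) (k' l' : Fin n') :
    superInner (coeffFun n (Sum.inr k) (Sum.inr l)) (coeffFun n' (Sum.inr k') (Sum.inr l')) =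
      if n = n' ∧ (k : ℕ) = k' ∧ (l : ℕ) = l' then -1 else 0 := by
  rw [coeffFun_inr_inr, coeffFun_inr_inr, superInner_smul_evenElt, integral_star_spinMatrix_mul]
  split_ifs with h
  · obtain ⟨rfl, -⟩ := h
    have : (n : ℂ) ≠ 0 := by exact_mod_cast k.pos.ne'
    push_cast
    field_simp
    ring
  · simp

lemma superInner_inl_inr (n n' : ℕ) (k l : Fin (n + 1)) (k' l' : Fin n') :
    superInner (coeffFun n (Sum.inl k) (Sum.inl l)) (coeffFun n' (Sum.inr k') (Sum.inr l')) = 0 := by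
  rw [coeffFun_inl_inl, coeffFun_inr_inr, superInner_smul_evenElt, integral_star_spinMatrix_mul]
  split_ifs with h
  -- Equal spins force `n' = n + 1`, so `α + β = -n/8 + (n+2)/8 = 1/4` and the prefactor `1 - 4(α +
  -- β)` vanishes.
  · obtain ⟨rfl, -⟩ := h
    push_cast
    ring
  · simp

lemma superInner_inr_inl (n n' : ℕ) (k l : Fin (n + 1)) (k' l' : Fin n') :
    superInner (coeffFun n' (Sum.inr k') (Sum.inr l')) (coeffFun n (Sum.inl k) (Sum.inl l)) = 0 := by
  rw [coeffFun_inl_inl, coeffFun_inr_inr, superInner_smul_evenElt, integral_star_spinMatrix_mul]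
  split_ifs with h
  · obtain ⟨rfl, -⟩ := h
    push_cast
    ring
  · simp

/-! ### Characters -/

lemma superChar_eq (n : ℕ) (g : SU2) : superChar n g =
    (spinMatrix (n + 1) g).trace • evenElt (-(n / 8)) -
      (spinMatrix n g).trace • evenElt ((n + 1) / 8) := by
  simp only [superChar, superTrace, irrep_inl_inl, irrep_inr_inr, ← Finset.sum_smul]
  rfl

lemma continuous_trace_spinMatrix (N : ℕ) : Continuous fun g => (spinMatrix N g).trace :=
  continuous_finsetSum _ fun k _ => continuous_spinMatrix N k k

/-- Orthonormality of the characters of `SU(2)`. -/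
lemma integral_star_trace_mul (N N' : ℕ) :
    ∫ g, star (spinMatrix N g).trace * (spinMatrix N' g).trace ∂haarSU2 =
      if N = N' ∧ N ≠ 0 then 1 else 0 := by
  have h : ∀ g, star (spinMatrix N g).trace * (spinMatrix N' g).trace =
      ∑ k, ∑ k', star (spinMatrix N g k k) * spinMatrix N' g k' k' := fun g => by
    simp [Matrix.trace, Finset.sum_mul_sum]
  simp only [h]
  rw [integral_finsetSum _ fun k _ => integrable_finsetSum _ fun k' _ =>
    integrable_of_continuous (continuous_star_spinMatrix_mul k k k' k')]
  simp only [integral_finsetSum _ fun k' _ =>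
    integrable_of_continuous (continuous_star_spinMatrix_mul _ _ k' k'),
    integral_star_spinMatrix_mul, and_self]
  rcases eq_or_ne N N' with rfl | hN
  · rcases eq_or_ne N 0 with rfl | h0
    · simp
    · simp [Fin.val_inj, h0]
  · simp [hN]

/-- Of the four products of traces, the even and odd ones contribute `n + 1` and `-n` when `n = n'`.
The mixed ones survive the Haar integral only for neighbouring `n`, `n'`, where their fibre factor
is zero. -/
lemma superInner_superChar (n n' : ℕ) :
    superInner (superChar n) (superChar n') = if n = n' then 1 else 0 := by
  have hint : ∀ (N N' : ℕ) (c : ℂ), Integrable (fun g =>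
      star (spinMatrix N g).trace * (spinMatrix N' g).trace * c) haarSU2 := fun N N' c =>
    (integrable_of_continuous
      ((continuous_trace_spinMatrix N).star.mul (continuous_trace_spinMatrix N'))).mul_const c
  have hsub : ∀ f h : SU2 → ℂ, Integrable f haarSU2 → Integrable h haarSU2 →
      Integrable (fun g => f g - h g) haarSU2 := fun _ _ hf hh => hf.sub hh
  simp only [superInner, superIntegral, fibreIntegral_eq, superChar_eq, map_sub, sub_mul, mul_sub]
  simp only [fibreLM_grConj_smul_evenElt_mul, integral_sigma]
  rw [integral_sub (hsub _ _ (hint _ _ _) (hint _ _ _)) (hsub _ _ (hint _ _ _) (hint _ _ _)),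
    integral_sub (hint _ _ _) (hint _ _ _), integral_sub (hint _ _ _) (hint _ _ _)]
  simp only [integral_mul_const, integral_star_trace_mul, add_left_inj]
  by_cases hn : n = n'
  · subst hn
    rcases eq_or_ne n 0 with rfl | h0
    · norm_num
    · simp [h0]
      ring
  · by_cases h2 : n = n' + 1
    · subst h2
      simp [show n' + 1 + 1 ≠ n' by omega]
      ring
    · by_cases h3 : n + 1 = n'
      · subst h3
        simp [show n ≠ n + 1 + 1 by omega]
        ring
      · simp [hn, h2, h3]

/-- Both sides satisfy the recurrence `x_{n+2} = 2 cos θ x_{n+1} - x_n`. -/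
lemma chebyshev_sub_mul_cos (n : ℕ) (θ : ℝ) :
    ((Polynomial.Chebyshev.U ℝ n).eval (Real.cos θ) -
      (Polynomial.Chebyshev.U ℝ (n - 1)).eval (Real.cos θ)) * Real.cos (θ / 2) =
        Real.cos ((2 * n + 1) * θ / 2) := by
  have hcos : ∀ φ, Real.cos (φ + θ) = 2 * Real.cos θ * Real.cos φ - Real.cos (φ - θ) := fun φ => by
    rw [Real.cos_add, Real.cos_sub]
    ring
  induction n using Nat.twoStepInduction with
  | zero => simp
  | one =>
    have := hcos (θ / 2)
    rw [show θ / 2 - θ = -(θ / 2) by ring, Real.cos_neg] at this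
    simp
    rw [show (2 + 1) * θ / 2 = θ / 2 + θ by ring, this]
    ring
  | more n ih1 ih2 =>
    have h := hcos ((2 * n + 3) * θ / 2)
    have hU1 := congrArg (Polynomial.eval (Real.cos θ)) (Polynomial.Chebyshev.U_add_two ℝ n)
    have hU2 := congrArg (Polynomial.eval (Real.cos θ)) (Polynomial.Chebyshev.U_add_two ℝ (n - 1))
    simp only [Polynomial.eval_sub, Polynomial.eval_mul, Polynomial.eval_ofNat,
      Polynomial.eval_X] at hU1 hU2
    push_cast at ih1 ih2 ⊢
    ring_nf at *
    linear_combination Real.cos (θ * (1 / 2)) * (hU1 - hU2) + 2 * Real.cos θ * ih2 - ih1 - h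

lemma chebyshev_add_mul_sin (n : ℕ) (θ : ℝ) :
    ((Polynomial.Chebyshev.U ℝ n).eval (Real.cos θ) +
      (Polynomial.Chebyshev.U ℝ (n - 1)).eval (Real.cos θ)) * Real.sin (θ / 2) =
        Real.sin ((2 * n + 1) * θ / 2) := by
  have hsin : ∀ φ, Real.sin (φ + θ) = 2 * Real.cos θ * Real.sin φ - Real.sin (φ - θ) := fun φ => by
    rw [Real.sin_add, Real.sin_sub]
    ring
  induction n using Nat.twoStepInduction with
  | zero => simp
  | one =>
    have := hsin (θ / 2)
    rw [show θ / 2 - θ = -(θ / 2) by ring, Real.sin_neg] at this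
    simp
    rw [show (2 + 1) * θ / 2 = θ / 2 + θ by ring, this]
    ring
  | more n ih1 ih2 =>
    have h := hsin ((2 * n + 3) * θ / 2)
    have hU1 := congrArg (Polynomial.eval (Real.cos θ)) (Polynomial.Chebyshev.U_add_two ℝ n)
    have hU2 := congrArg (Polynomial.eval (Real.cos θ)) (Polynomial.Chebyshev.U_add_two ℝ (n - 1))
    simp only [Polynomial.eval_sub, Polynomial.eval_mul, Polynomial.eval_ofNat,
      Polynomial.eval_X] at hU1 hU2
    push_cast at ih1 ih2 ⊢
    ring_nf at *
    linear_combination Real.sin (θ * (1 / 2)) * (hU1 + hU2) + 2 * Real.cos θ * ih2 - ih1 - h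

/-- The `η̄η` coefficients regroup as `-n/8 = (1 - (2n+1))/16` on `U_n` and `-(n+1)/8 = -(1 +
(2n+1))/16` on `U_{n-1}`. -/
lemma superChar_eq_chebyshev (n : ℕ) (g : SU2) (θ : ℝ)
    (h : Matrix.trace g.1 = ((2 * Real.cos θ : ℝ) : ℂ)) : superChar n g =
      (((Polynomial.Chebyshev.U ℝ n).eval (Real.cos θ) -
        (Polynomial.Chebyshev.U ℝ (n - 1)).eval (Real.cos θ) : ℝ) : ℂ) •
          (1 + (1 / 16 : ℂ) • (etaBar * eta)) -
      (((2 * n + 1) / 16 * ((Polynomial.Chebyshev.U ℝ n).eval (Real.cos θ) +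
        (Polynomial.Chebyshev.U ℝ (n - 1)).eval (Real.cos θ)) : ℝ) : ℂ) • (etaBar * eta) := by
  rw [superChar_eq, trace_spinMatrix _ g θ h, trace_spinMatrix _ g θ h]
  simp only [evenElt]
  push_cast
  rw [add_sub_cancel_right]
  module

end

end UOSp12

theorem mainTheorem3 :
    -- integrability of the products of matrix coefficients and of characters
    (∀ (n n' : ℕ) (a b : UOSp12.Idx n) (a' b' : UOSp12.Idx n'),
      UOSp12.SuperIntegrable (fun g =>
        UOSp12.grConj (UOSp12.coeffFun n a b g) * UOSp12.coeffFun n' a' b' g)) ∧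
    (∀ n n' : ℕ, UOSp12.SuperIntegrable (fun g =>
        UOSp12.grConj (UOSp12.superChar n g) * UOSp12.superChar n' g)) ∧
    -- matrix coefficients of the even block
    (∀ (n n' : ℕ) (k l : Fin (n + 1)) (k' l' : Fin (n' + 1)),
      UOSp12.superInner (UOSp12.coeffFun n (Sum.inl k) (Sum.inl l))
          (UOSp12.coeffFun n' (Sum.inl k') (Sum.inl l')) =
        if n = n' ∧ (k : ℕ) = k' ∧ (l : ℕ) = l' then 1 else 0) ∧
    -- matrix coefficients of the odd block
    (∀ (n n' : ℕ) (k l : Fin n) (k' l' : Fin n'),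
      UOSp12.superInner (UOSp12.coeffFun n (Sum.inr k) (Sum.inr l))
          (UOSp12.coeffFun n' (Sum.inr k') (Sum.inr l')) =
        if n = n' ∧ (k : ℕ) = k' ∧ (l : ℕ) = l' then -1 else 0) ∧
    -- matrix coefficients of the even block against those of the odd block
    (∀ (n n' : ℕ) (k l : Fin (n + 1)) (k' l' : Fin n'),
      UOSp12.superInner (UOSp12.coeffFun n (Sum.inl k) (Sum.inl l))
          (UOSp12.coeffFun n' (Sum.inr k') (Sum.inr l')) = 0 ∧
      UOSp12.superInner (UOSp12.coeffFun n' (Sum.inr k') (Sum.inr l'))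
          (UOSp12.coeffFun n (Sum.inl k) (Sum.inl l)) = 0) ∧
    -- orthonormality of the super characters
    (∀ n n' : ℕ, UOSp12.superInner (UOSp12.superChar n) (UOSp12.superChar n') =
      if n = n' then 1 else 0) ∧
    -- the closed form; the two quotients are extended continuously over the zeros of the
    -- denominators, and `4 j + 1 = 2 n + 1`
    (∀ n : ℕ, ∃ A B : ℝ → ℝ, Continuous A ∧ Continuous B ∧
      (∀ θ : ℝ, Real.cos (θ / 2) ≠ 0 →
        A θ = Real.cos ((2 * n + 1) * θ / 2) / Real.cos (θ / 2)) ∧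
      (∀ θ : ℝ, Real.sin (θ / 2) ≠ 0 →
        B θ = Real.sin ((2 * n + 1) * θ / 2) / Real.sin (θ / 2)) ∧
      ∀ (g : UOSp12.SU2) (θ : ℝ), Matrix.trace g.1 = ((2 * Real.cos θ : ℝ) : ℂ) →
        UOSp12.superChar n g =
          (A θ : ℂ) • (1 + (1 / 16 : ℂ) • (UOSp12.etaBar * UOSp12.eta)) -
            (((2 * n + 1) / 16 * B θ : ℝ) : ℂ) • (UOSp12.etaBar * UOSp12.eta)) := by
  refine ⟨fun n n' a b a' b' => UOSp12.superIntegrable_grConj_mul (UOSp12.coeffFun_mem n a b)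
      (UOSp12.coeffFun_mem n' a' b'),
    fun n n' => UOSp12.superIntegrable_grConj_mul (UOSp12.superChar_mem n)
      (UOSp12.superChar_mem n'),
    UOSp12.superInner_inl_inl, UOSp12.superInner_inr_inr,
    fun n n' k l k' l' => ⟨UOSp12.superInner_inl_inr n n' k l k' l',
      UOSp12.superInner_inr_inl n n' k l k' l'⟩,
    UOSp12.superInner_superChar, fun n =>
    -- The continuous extensions are `U_n - U_{n-1}` and `U_n + U_{n-1}` at `cos θ`, found by
    -- unification.
    ⟨_, _, ?_, ?_, fun θ hθ => eq_div_of_mul_eq hθ (UOSp12.chebyshev_sub_mul_cos n θ),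
      fun θ hθ => eq_div_of_mul_eq hθ (UOSp12.chebyshev_add_mul_sin n θ),
      UOSp12.superChar_eq_chebyshev n⟩⟩
  · exact ((Polynomial.continuous _).comp Real.continuous_cos).sub
      ((Polynomial.continuous _).comp Real.continuous_cos)
  · exact ((Polynomial.continuous _).comp Real.continuous_cos).add
      ((Polynomial.continuous _).comp Real.continuous_cos)
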